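/- Let $k,\ell,m$ be nonnegative integers with $m$ even, put $n=k+\ell+m$ and $r=k+\ell$, and assume $n\ge 1$. For a real $r\times n$ matrix $U$ with columns $U(1),\dots,U(n)$, define $U(j)$ for all $j\in\mathbb Z$ by $U(j+n)=(-1)^{k-1}U(j)$. Let $\mathrm{Mat}^\circ(r,n)$ be the set of those $U$ for which $U(j-\ell),U(j-\ell+1),\dots,U(j+k-1)$ is a basis of $\mathbb R^{r}$ for every $j\in\mathbb Z$. For such $U$ and $j\in\mathbb Z$ let $\tilde U(j)\in\mathbb R^{r}$ be the unique vector with $$\langle \tilde U(j),U(j-\ell)\rangle=(-1)^j,\qquad \langle \tilde U(j),U(j-\ell+1)\rangle=\dots=\langle \tilde U(j),U(j+k-1)\rangle=0,$$ (no condition if $r=0$), and let the twist $\tau(U)$ be the $r\times n$ matrix with columns $\tilde U(1),\dots,\tilde U(n)$. Let $\mathrm{Gr}^\circ(r,n)\subset\mathrm{Gr}(r,n)$ be the set of row spans of the matrices in $\mathrm{Mat}^\circ(r,n)$. The canonical form $\omega_{r,n}$ is the rational differential form of degree $r(n-r)$ on $\mathrm{Gr}(r,n)$, defined up to a sign, which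 at the row span $X$ of a block matrix $[\mathrm{Id}_r\mid A]$, $A=(a_{i,j})$ of size $r\times(n-r)$, is $$\omega_{r,n}(X)=\pm\frac{da_{1,1}\wedge da_{1,2}\wedge\dots\wedge da_{r,n-r}}{\prod_{i=1}^n\Delta_{\{i,i+1,\dots,i+r-1\}}([\mathrm{Id}_r\mid A])},$$ where $\Delta_I$ is the maximal minor with column set $I$ and indices are taken modulo $n$. Then $\tau$ maps $\mathrm{Mat}^\circ(r,n)$ to itself, and the row span of $\tau(U)$ depends only on the row span of $U\in\mathrm{Mat}^\circ(r,n)$. Every point of $\mathrm{Gr}^\circ(r,n)$ is the row span of some $[\mathrm{Id}_r\mid A]$, and $\mathrm{Gr}^\circ(r,n)$ corresponds to a dense open set of matrices $A$. The induced map $\tau:\mathrm{Gr}(r,n)\dashrightarrow\mathrm{Gr}(r,n)$ is rational: it maps $\mathrm{Gr}^\circ(r,n)$ to itself, and there it is given, in the coordinates $A$, by quotients of polynomials with nowhere vanishing denominators; in particular it is differentiable. It preserves the canonical form up to a sign: $$\tau^*\omega_{r,n}=\pm\,\omega_{r,n},$$ that is, the equality holds at every point of $\mathrm{Gr}^\circ(r,n)$,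 with one and the same sign. -/

import Mathlib

namespace GrassmannTwist

open scoped Matrix

/-- The row span of an `r × n` real matrix, as a subspace of `ℝⁿ`. -/
def rowSpan {r n : ℕ} (U : Matrix (Fin r) (Fin n) ℝ) : Submodule ℝ (Fin n → ℝ) :=
  Submodule.span ℝ (Set.range U.row)

/-- The Grassmannian `Gr(r, n)`: the set of `r`-dimensional subspaces of `ℝⁿ`. -/
def Gr (r n : ℕ) : Set (Submodule ℝ (Fin n → ℝ)) :=
  {X | Module.finrank ℝ X = r}

/-- The columns `U(j)`, `j ∈ ℤ`, of a matrix with `n` columns.  For `1 ≤ j ≤ n` this is the `j`-th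
column (of index `j - 1` in `Fin n`), and `U(j + n) = (-1)^(k-1) U(j)` for all `j`. -/
noncomputable def column {r n : ℕ} [NeZero n] (k : ℕ) (U : Matrix (Fin r) (Fin n) ℝ) (j : ℤ) :
    Fin r → ℝ := fun a =>
  ((-1 : ℝ) ^ ((k : ℤ) - 1)) ^ ((j - 1) / (n : ℤ)) *
    U a ⟨((j - 1) % (n : ℤ)).toNat, by
      have hn : (0 : ℤ) < n := by exact_mod_cast Nat.pos_of_ne_zero (NeZero.ne n)
      have h1 := Int.emod_nonneg (j - 1) hn.ne'
      have h2 := Int.emod_lt_of_pos (j - 1) hn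
      omega⟩

theorem column_natCast {r n : ℕ} [NeZero n] (k : ℕ) (U : Matrix (Fin r) (Fin n) ℝ) (c : Fin n)
    (a : Fin r) : column k U ((c : ℤ) + 1) a = U a c := by
  have hc : (c : ℤ) < n := by exact_mod_cast c.2
  have h0 : (0 : ℤ) ≤ c := by positivity
  have h1 : ((c : ℤ) + 1 - 1) / (n : ℤ) = 0 := by
    rw [add_sub_cancel_right]; exact Int.ediv_eq_zero_of_lt h0 hc
  have h2 : ((c : ℤ) + 1 - 1) % (n : ℤ) = c := by
    rw [add_sub_cancel_right]; exact Int.emod_eq_of_lt h0 hc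
  simp only [column, h1, zpow_zero, one_mul]
  exact congrArg (U a) (Fin.ext (by simp only [h2, Int.toNat_natCast]))

theorem column_add_period {r n : ℕ} [NeZero n] (k : ℕ) (U : Matrix (Fin r) (Fin n) ℝ) (j : ℤ) :
    column k U (j + n) = (-1 : ℝ) ^ ((k : ℤ) - 1) • column k U j := by
  have hn : (n : ℤ) ≠ 0 := by exact_mod_cast NeZero.ne n
  have h1 : (j + n - 1) / (n : ℤ) = (j - 1) / (n : ℤ) + 1 := by
    rw [show j + (n : ℤ) - 1 = (j - 1) + n by ring, Int.add_ediv_of_dvd_right (dvd_refl _),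
      Int.ediv_self hn]
  have h2 : (j + n - 1) % (n : ℤ) = (j - 1) % (n : ℤ) := by
    rw [show j + (n : ℤ) - 1 = (j - 1) + n by ring, Int.add_emod_right]
  have h3 : ((-1 : ℝ) ^ ((k : ℤ) - 1)) ≠ 0 := zpow_ne_zero _ (by norm_num)
  funext a
  simp only [column, h1, h2, Pi.smul_apply, smul_eq_mul]
  rw [zpow_add_one₀ h3]
  ring

/-- The square matrix `[U(j - ℓ) | U(j - ℓ + 1) | ... | U(j + k - 1)]`. -/
noncomputable def window {n : ℕ} [NeZero n] (k ℓ : ℕ) (U : Matrix (Fin (k + ℓ)) (Fin n) ℝ)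
    (j : ℤ) : Matrix (Fin (k + ℓ)) (Fin (k + ℓ)) ℝ :=
  Matrix.of fun a b => column k U (j - ℓ + (b : ℕ)) a

/-- `Mat°(k + ℓ, n)`: for every `j ∈ ℤ`, the vectors `U(j - ℓ), ..., U(j + k - 1)` form a basis
of `ℝ^(k + ℓ)`. -/
def MatCirc (k ℓ n : ℕ) [NeZero n] : Set (Matrix (Fin (k + ℓ)) (Fin n) ℝ) :=
  {U | ∀ j : ℤ,
    LinearIndependent ℝ (fun b : Fin (k + ℓ) => column k U (j - ℓ + (b : ℕ))) ∧
    Submodule.span ℝ (Set.range fun b : Fin (k + ℓ) => column k U (j - ℓ + (b : ℕ))) = ⊤}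

/-- The vector `Ũ(j)`, written as `(-1)^j` times the first row of the inverse of
`[U(j - ℓ) | ... | U(j + k - 1)]`; the defining orthogonality relations are
`eq_twistColumn_iff` below. -/
noncomputable def twistColumn {n : ℕ} [NeZero n] (k ℓ : ℕ) (U : Matrix (Fin (k + ℓ)) (Fin n) ℝ)
    (j : ℤ) : Fin (k + ℓ) → ℝ :=
  ((window k ℓ U j)ᵀ)⁻¹ *ᵥ fun b : Fin (k + ℓ) => if (b : ℕ) = 0 then (-1 : ℝ) ^ j else 0

/-- The twist map `τ` on matrices: `τ(U)` has columns `Ũ(1), ..., Ũ(n)`. -/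
noncomputable def twist {n : ℕ} [NeZero n] (k ℓ : ℕ) (U : Matrix (Fin (k + ℓ)) (Fin n) ℝ) :
    Matrix (Fin (k + ℓ)) (Fin n) ℝ :=
  Matrix.of fun a c => twistColumn k ℓ U ((c : ℤ) + 1) a

theorem isUnit_window {k ℓ n : ℕ} [NeZero n] {U : Matrix (Fin (k + ℓ)) (Fin n) ℝ}
    (hU : U ∈ MatCirc k ℓ n) (j : ℤ) : IsUnit (window k ℓ U j) := by
  rw [← Matrix.linearIndependent_cols_iff_isUnit]
  exact (hU j).1

/-- `Ũ(j)` is the unique vector with `⟨Ũ(j), U(j - ℓ)⟩ = (-1)^j` and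
`⟨Ũ(j), U(j - ℓ + 1)⟩ = ... = ⟨Ũ(j), U(j + k - 1)⟩ = 0`. -/
theorem eq_twistColumn_iff {k ℓ n : ℕ} [NeZero n] {U : Matrix (Fin (k + ℓ)) (Fin n) ℝ}
    (hU : U ∈ MatCirc k ℓ n) (j : ℤ) (v : Fin (k + ℓ) → ℝ) :
    v = twistColumn k ℓ U j ↔
      ∀ b : Fin (k + ℓ), v ⬝ᵥ column k U (j - ℓ + (b : ℕ)) =
        if (b : ℕ) = 0 then (-1 : ℝ) ^ j else 0 := by
  have hu : IsUnit ((window k ℓ U j)ᵀ).det := by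
    rw [Matrix.det_transpose]
    exact (Matrix.isUnit_iff_isUnit_det _).1 (isUnit_window hU j)
  have key : (∀ b : Fin (k + ℓ), v ⬝ᵥ column k U (j - ℓ + (b : ℕ)) =
        if (b : ℕ) = 0 then (-1 : ℝ) ^ j else 0) ↔
      (window k ℓ U j)ᵀ *ᵥ v = fun b : Fin (k + ℓ) => if (b : ℕ) = 0 then (-1 : ℝ) ^ j else 0 := by
    rw [funext_iff]
    refine forall_congr' fun b => ?_
    rw [dotProduct_comm]
    rfl
  rw [key]
  constructor
  · rintro rfl
    rw [twistColumn, Matrix.mulVec_mulVec, Matrix.mul_nonsing_inv _ hu, Matrix.one_mulVec]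
  · intro h
    rw [twistColumn, ← h, Matrix.mulVec_mulVec, Matrix.nonsing_inv_mul _ hu, Matrix.one_mulVec]

theorem window_mul {k ℓ n : ℕ} [NeZero n] (g : Matrix (Fin (k + ℓ)) (Fin (k + ℓ)) ℝ)
    (U : Matrix (Fin (k + ℓ)) (Fin n) ℝ) (j : ℤ) :
    window k ℓ (g * U) j = g * window k ℓ U j := by
  ext a b
  simp only [window, column, Matrix.of_apply, Matrix.mul_apply, Finset.mul_sum]
  exact Finset.sum_congr rfl fun _ _ => by ring

theorem twist_mul {k ℓ n : ℕ} [NeZero n] (g : Matrix (Fin (k + ℓ)) (Fin (k + ℓ)) ℝ)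
    (U : Matrix (Fin (k + ℓ)) (Fin n) ℝ) :
    twist k ℓ (g * U) = gᵀ⁻¹ * twist k ℓ U := by
  ext a c
  rw [twist, Matrix.of_apply, twistColumn, window_mul, Matrix.transpose_mul, Matrix.mul_inv_rev,
    ← Matrix.mulVec_mulVec]
  rfl

theorem rowSpan_mul_le {r n : ℕ} (g : Matrix (Fin r) (Fin r) ℝ) (U : Matrix (Fin r) (Fin n) ℝ) :
    rowSpan (g * U) ≤ rowSpan U := by
  refine Submodule.span_le.2 ?_
  rintro _ ⟨a, rfl⟩
  have : (g * U).row a = ∑ b, g a b • U.row b := by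
    funext c
    simp [Matrix.row, Matrix.mul_apply]
  rw [this]
  exact Submodule.sum_mem _ fun b _ => Submodule.smul_mem _ _ (Submodule.subset_span ⟨b, rfl⟩)

theorem exists_mul_of_rowSpan_le {r n : ℕ} {U U' : Matrix (Fin r) (Fin n) ℝ}
    (h : rowSpan U' ≤ rowSpan U) : ∃ g : Matrix (Fin r) (Fin r) ℝ, U' = g * U := by
  have h1 : ∀ a, ∃ c : Fin r → ℝ, ∑ b, c b • U.row b = U'.row a := fun a =>
    (Submodule.mem_span_range_iff_exists_fun ℝ).1 (h (Submodule.subset_span ⟨a, rfl⟩))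
  choose g hg using h1
  refine ⟨Matrix.of g, ?_⟩
  ext a c
  have := congrFun (hg a) c
  simp [Matrix.row] at this
  simp [Matrix.mul_apply, this]

theorem rowSpan_twist_le {k ℓ n : ℕ} [NeZero n] {U U' : Matrix (Fin (k + ℓ)) (Fin n) ℝ}
    (h : rowSpan U = rowSpan U') : rowSpan (twist k ℓ U') ≤ rowSpan (twist k ℓ U) := by
  obtain ⟨g, rfl⟩ := exists_mul_of_rowSpan_le h.ge
  rw [twist_mul]
  exact rowSpan_mul_le _ _

/-- `Gr°(k + ℓ, n)`: the points of the Grassmannian that are represented by matrices in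
`Mat°(k + ℓ, n)`, i.e. those with nonzero circular minors.  This is the domain of `τ`. -/
def GrCirc (k ℓ n : ℕ) [NeZero n] : Set (Submodule ℝ (Fin n → ℝ)) :=
  {X | X ∈ Gr (k + ℓ) n ∧ ∃ U ∈ MatCirc k ℓ n, rowSpan U = X}

open Classical in
/-- The rational map `τ : Gr(k + ℓ, n) ⇢ Gr(k + ℓ, n)` induced by the twist map on matrices, with
domain `Gr°(k + ℓ, n)` (and a junk value elsewhere). -/
noncomputable def twistGr (k ℓ n : ℕ) [NeZero n] (X : Submodule ℝ (Fin n → ℝ)) :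
    Submodule ℝ (Fin n → ℝ) :=
  if h : ∃ U ∈ MatCirc k ℓ n, rowSpan U = X then rowSpan (twist k ℓ h.choose) else X

/-- The map `τ` on the Grassmannian does not depend on the representing matrix. -/
theorem twistGr_rowSpan {k ℓ n : ℕ} [NeZero n] {U : Matrix (Fin (k + ℓ)) (Fin n) ℝ}
    (hU : U ∈ MatCirc k ℓ n) : twistGr k ℓ n (rowSpan U) = rowSpan (twist k ℓ U) := by
  have h : ∃ U' ∈ MatCirc k ℓ n, rowSpan U' = rowSpan U := ⟨U, hU, rfl⟩
  rw [twistGr, dif_pos h]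
  exact le_antisymm (rowSpan_twist_le h.choose_spec.2.symm) (rowSpan_twist_le h.choose_spec.2)

/-- The coordinate space of `r × (n - r)` matrices `A`, with coordinates `a_{i,j}`. -/
abbrev Coords (r n : ℕ) : Type := Fin r × Fin (n - r) → ℝ

/-- The `r × n` block matrix `[Id_r | A]`. -/
def chartMatrix {r n : ℕ} (A : Coords r n) : Matrix (Fin r) (Fin n) ℝ :=
  Matrix.of fun a c =>
    if h : (c : ℕ) < r then (if (a : ℕ) = c then 1 else 0)
    else A (a, ⟨(c : ℕ) - r, Nat.sub_lt_sub_right (not_lt.1 h) c.2⟩)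

/-- The chart of `Gr(r, n)` which sends `A` to the row span of `[Id_r | A]`. -/
def chart {r n : ℕ} (A : Coords r n) : Submodule ℝ (Fin n → ℝ) := rowSpan (chartMatrix A)

/-- The matrix `A` such that `X` is the row span of `[Id_r | A]` (junk if there is none). -/
noncomputable def coord (r : ℕ) {n : ℕ} (X : Submodule ℝ (Fin n → ℝ)) : Coords r n :=
  Function.invFun (chart (r := r) (n := n)) X

theorem chart_injective {r n : ℕ} (h : r ≤ n) : Function.Injective (chart (r := r) (n := n)) := by
  intro A B hAB
  obtain ⟨g, hg⟩ := exists_mul_of_rowSpan_le (U := chartMatrix B) (U' := chartMatrix A) hAB.le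
  have hg1 : g = 1 := by
    ext a b
    have := congrFun (congrFun hg a) ⟨b, b.2.trans_le h⟩
    simpa [Matrix.mul_apply, chartMatrix, Matrix.one_apply, ← Fin.ext_iff, eq_comm] using this
  rw [hg1, Matrix.one_mul] at hg
  funext ⟨a, c⟩
  have := congrFun (congrFun hg a) ⟨r + c, by omega⟩
  simpa [chartMatrix] using this

theorem coord_chart {r n : ℕ} (h : r ≤ n) (A : Coords r n) : coord r (chart A) = A :=
  Function.leftInverse_invFun (chart_injective h) A

/-- The product of the `n` circular `r × r` minors of `M`, in the columns
`i, i + 1, ..., i + r - 1` modulo `n`.  The columns are kept in this cyclic order; sorting them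
changes the product by a sign which depends on `r` and `n` only. -/
def circularMinors {r n : ℕ} (M : Matrix (Fin r) (Fin n) ℝ) : ℝ :=
  ∏ i : Fin n,
    (M.submatrix id fun b : Fin r => (⟨((i : ℕ) + b) % n, Nat.mod_lt _ i.pos⟩ : Fin n)).det

/-- Forms of top degree `r (n - r)` on the coordinate space, which is the tangent space of
`Gr(r, n)` in the chart `[Id_r | A]`. -/
abbrev TopForm (r n : ℕ) : Type :=
  AlternatingMap ℝ (Coords r n) ℝ (Fin r × Fin (n - r))

/-- A representative (with sign `+`) of the canonical form `ω_{r,n}` of `Gr(r, n)`: at the row span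
of `[Id_r | A]` it is `da_{1,1} ∧ da_{1,2} ∧ ... ∧ da_{r,n-r}` divided by the product of the
circular minors of `[Id_r | A]`. -/
noncomputable def canonicalForm (r n : ℕ) (X : Submodule ℝ (Fin n → ℝ)) : TopForm r n :=
  (circularMinors (chartMatrix (coord r X)))⁻¹ • (Pi.basisFun ℝ (Fin r × Fin (n - r))).det

/-- The map `F` between subspaces, expressed in the chart `[Id_r | A]`. -/
noncomputable def inChart (r : ℕ) {n : ℕ} (F : Submodule ℝ (Fin n → ℝ) → Submodule ℝ (Fin n → ℝ))
    (A : Coords r n) : Coords r n :=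
  coord r (F (chart A))

/-- The pullback `F^* ω` of a top form along a map `F`, at `X`: the form `ω` at `F(X)`, composed
with the differential of `F` at `X`. -/
noncomputable def pullback (r : ℕ) {n : ℕ}
    (F : Submodule ℝ (Fin n → ℝ) → Submodule ℝ (Fin n → ℝ))
    (ω : Submodule ℝ (Fin n → ℝ) → TopForm r n) (X : Submodule ℝ (Fin n → ℝ)) : TopForm r n :=
  (ω (F X)).compLinearMap (fderiv ℝ (inChart r F) (coord r X)).toLinearMap

end GrassmannTwist

open GrassmannTwist

/-! Write `U = [Id | A]` and `V = τ(U) = P [Id | B]`, where `P` is the left block of `V` and `B =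
f(A)` is the twist in the chart. The form at `A` is the standard volume form divided by the product
of circular minors of `U`, so the claim is the Jacobian identity `circ[Id | A] · det Df = ± circ[Id
| B]`, with a sign independent of `A`.

By definition of the twist, the `r n` pairings of column `c` of `V` with the columns `c - ℓ + b`, `b
< r`, of `U` are constants (`sum_twist_mul`). Differentiating gives `K(dV) + R(dU) = 0`, where `K`
pairs with `U` and `R` pairs with `V`. Grouped by columns, both are block diagonal up to
permutations, and the blocks are windows of consecutive columns. Hence `det K = circ U` and `det R =
± circ V` (`det_pairLeft`, `exists_det_pairRight`).

In the chart, `dU = [0 | δ]` fills only `r (n - r)` of the `r n` dimensions. The missing ones come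
from the symmetry `τ(gU) = g⁻ᵀ τ(U)`: adding `X U` to `dU` adds `-Xᵀ V` to `dV`. In the coordinates
`(X, δ)` all the maps involved are block triangular, the powers of `det P` cancel, and the Jacobian
identity remains (`exists_det_of_pairing`).

The twist preserves nonvanishing of the circular minors by a triangular product (`twist_mem`).
Rationality follows from Cramer's rule, and density from the fact that a nonzero polynomial vanishes
on no open set. -/

namespace GrassmannTwist

open scoped Matrix Topology Kronecker

/-! ### Cyclic windows of columns, circular minors and the constant pairings. -/

section CyclicColumns

variable {r k ℓ n : ℕ}

/-- The sign `(-1)^((k-1) ⌊(j-1)/n⌋)` relating `U(j)` to a column of `U`. -/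
noncomputable def columnSign (k n : ℕ) (j : ℤ) : ℝ := ((-1 : ℝ) ^ ((k : ℤ) - 1)) ^ ((j - 1) / (n : ℤ))

theorem columnSign_ne_zero (j : ℤ) : columnSign k n j ≠ 0 :=
  zpow_ne_zero _ (zpow_ne_zero _ (by norm_num))

/-- The value of the pairing of the column `c` of `τ(U)` with the column `c - ℓ + b` of `U`. -/
noncomputable def pairingValue (k ℓ n : ℕ) (c b : ℕ) : ℝ :=
  (columnSign k n ((c : ℤ) + 1 - ℓ + b))⁻¹ * if b = 0 then (-1 : ℝ) ^ ((c : ℤ) + 1) else 0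

theorem pairingValue_zero_ne_zero (c : ℕ) : pairingValue k ℓ n c 0 ≠ 0 := by
  rw [pairingValue, if_pos rfl]
  exact mul_ne_zero (inv_ne_zero (columnSign_ne_zero _)) (zpow_ne_zero _ (by norm_num))

theorem pairingValue_of_ne_zero (c : ℕ) {b : ℕ} (hb : b ≠ 0) : pairingValue k ℓ n c b = 0 := by
  rw [pairingValue, if_neg hb, mul_zero]

variable [NeZero n]

/-- The residue of an integer modulo `n`, as an element of `Fin n`. -/
def cyc (n : ℕ) [NeZero n] (j : ℤ) : Fin n :=
  ⟨(j % (n : ℤ)).toNat, by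
    have hn : (0 : ℤ) < n := by exact_mod_cast Nat.pos_of_ne_zero (NeZero.ne n)
    have h1 := Int.emod_nonneg j hn.ne'
    have h2 := Int.emod_lt_of_pos j hn
    omega⟩

theorem coe_cyc (j : ℤ) : ((cyc n j : ℕ) : ℤ) = j % n := by
  have hn : (n : ℤ) ≠ 0 := by exact_mod_cast NeZero.ne n
  exact Int.toNat_of_nonneg (Int.emod_nonneg j hn)

theorem cyc_eq_cyc {i j : ℤ} : cyc n i = cyc n j ↔ i % n = j % n := by
  rw [Fin.ext_iff, ← Nat.cast_inj (R := ℤ), coe_cyc, coe_cyc]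

theorem cyc_coe (c : Fin n) : cyc n ((c : ℕ) : ℤ) = c := by
  rw [Fin.ext_iff, ← Nat.cast_inj (R := ℤ), coe_cyc]
  exact Int.emod_eq_of_lt (by positivity) (by exact_mod_cast c.2)

theorem cyc_coe_add (i z : ℤ) : cyc n (((cyc n i : ℕ) : ℤ) + z) = cyc n (i + z) := by
  rw [cyc_eq_cyc, coe_cyc, Int.emod_add_emod]

theorem cyc_add_injective (i : ℤ) (h : r ≤ n) :
    Function.Injective fun b : Fin r => cyc n (i + (b : ℕ)) := by
  intro a b hab
  have h1 : ((a : ℕ) : ℤ) % n = ((b : ℕ) : ℤ) % n := by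
    have := cyc_eq_cyc.1 hab
    exact Int.ModEq.add_left_cancel' i this
  rw [Int.emod_eq_of_lt (by positivity) (by exact_mod_cast a.2.trans_le h),
    Int.emod_eq_of_lt (by positivity) (by exact_mod_cast b.2.trans_le h)] at h1
  exact Fin.ext (by exact_mod_cast h1)

/-- Translation by an integer modulo `n`. -/
def cycShift (n : ℕ) [NeZero n] (z : ℤ) : Equiv.Perm (Fin n) where
  toFun c := cyc n (((c : ℕ) : ℤ) + z)
  invFun c := cyc n (((c : ℕ) : ℤ) + -z)
  left_inv c := by simp only [cyc_coe_add, add_neg_cancel_right, cyc_coe]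
  right_inv c := by simp only [cyc_coe_add, neg_add_cancel_right, cyc_coe]

theorem cycShift_apply (z : ℤ) (c : Fin n) :
    cycShift n z c = cyc n (((c : ℕ) : ℤ) + z) := rfl

/-- The submatrix of `r` cyclically consecutive columns of `M`, starting with the column `i`. -/
def cyclicWindow (M : Matrix (Fin r) (Fin n) ℝ) (i : ℤ) : Matrix (Fin r) (Fin r) ℝ :=
  M.submatrix id fun b : Fin r => cyc n (i + (b : ℕ))

theorem cyclicWindow_cyc (M : Matrix (Fin r) (Fin n) ℝ) (i z : ℤ) :
    cyclicWindow M ((cyc n i : ℕ) + z) = cyclicWindow M (i + z) := by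
  ext a b
  simp only [cyclicWindow, Matrix.submatrix_apply, add_assoc, cyc_coe_add]

theorem cyclicWindow_mul (g : Matrix (Fin r) (Fin r) ℝ) (M : Matrix (Fin r) (Fin n) ℝ) (i : ℤ) :
    cyclicWindow (g * M) i = g * cyclicWindow M i := by
  ext a b
  simp [cyclicWindow, Matrix.mul_apply]

theorem circularMinors_eq (M : Matrix (Fin r) (Fin n) ℝ) :
    circularMinors M = ∏ i : Fin n, (cyclicWindow M (i : ℕ)).det := by
  refine Finset.prod_congr rfl fun i _ => congrArg Matrix.det ?_
  exact congrArg (M.submatrix id) (funext fun b => Fin.ext rfl)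

/-- The product runs over all cyclic windows, so its starting point is immaterial; the pairing
matrices below have their blocks shifted by such a `z`. -/
theorem circularMinors_eq_shift (M : Matrix (Fin r) (Fin n) ℝ) (z : ℤ) :
    circularMinors M = ∏ i : Fin n, (cyclicWindow M ((i : ℕ) + z)).det := by
  rw [circularMinors_eq, ← Equiv.prod_comp (cycShift n z)]
  refine Finset.prod_congr rfl fun i _ => ?_
  rw [cycShift_apply, ← add_zero (((cyc n _ : ℕ) : ℤ)), cyclicWindow_cyc, add_zero]

theorem circularMinors_mul (g : Matrix (Fin r) (Fin r) ℝ) (M : Matrix (Fin r) (Fin n) ℝ) :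
    circularMinors (g * M) = g.det ^ n * circularMinors M := by
  simp [circularMinors_eq, cyclicWindow_mul, Finset.prod_mul_distrib]

theorem circularMinors_ne_zero_iff {M : Matrix (Fin r) (Fin n) ℝ} :
    circularMinors M ≠ 0 ↔ ∀ i : ℤ, (cyclicWindow M i).det ≠ 0 := by
  rw [circularMinors_eq, Finset.prod_ne_zero_iff]
  constructor
  · intro h i
    have := h (cyc n i) (Finset.mem_univ _)
    rwa [← add_zero (((cyc n _ : ℕ) : ℤ)), cyclicWindow_cyc, add_zero] at this
  · intro h i _
    exact h _

theorem column_eq (U : Matrix (Fin r) (Fin n) ℝ) (j : ℤ) (a : Fin r) :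
    column k U j a = columnSign k n j * U a (cyc n (j - 1)) := rfl

theorem window_eq (U : Matrix (Fin (k + ℓ)) (Fin n) ℝ) (j : ℤ) :
    window k ℓ U j = Matrix.of fun a b : Fin (k + ℓ) =>
      columnSign k n (j - ℓ + (b : ℕ)) * cyclicWindow U (j - 1 - ℓ) a b := by
  ext a b
  simp only [window, Matrix.of_apply, column_eq, cyclicWindow, Matrix.submatrix_apply, id]
  congr 3
  ring

theorem det_window_ne_zero_iff (U : Matrix (Fin (k + ℓ)) (Fin n) ℝ) (j : ℤ) :
    (window k ℓ U j).det ≠ 0 ↔ (cyclicWindow U (j - 1 - ℓ)).det ≠ 0 := by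
  rw [window_eq, Matrix.det_mul_row, mul_ne_zero_iff, and_iff_right]
  exact Finset.prod_ne_zero_iff.2 fun b _ => columnSign_ne_zero _

/-- The signs in the quasi-periodic extension only rescale columns, so the basis condition is a
condition on plain cyclic windows. The window at `j` starts at index `j - 1 - ℓ` because the columns
`U(j)` are numbered from 1. -/
theorem mem_MatCirc_iff {U : Matrix (Fin (k + ℓ)) (Fin n) ℝ} :
    U ∈ MatCirc k ℓ n ↔ circularMinors U ≠ 0 := by
  rw [circularMinors_ne_zero_iff]
  have key : ∀ j : ℤ, LinearIndependent ℝ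
      (fun b : Fin (k + ℓ) => column k U (j - ℓ + (b : ℕ))) ↔
        (cyclicWindow U (j - 1 - ℓ)).det ≠ 0 := fun j => by
    rw [← det_window_ne_zero_iff, ← isUnit_iff_ne_zero, ← Matrix.isUnit_iff_isUnit_det,
      ← Matrix.linearIndependent_cols_iff_isUnit]
    rfl
  constructor
  · intro h i
    have := (key (i + 1 + ℓ)).1 (h _).1
    rwa [show i + 1 + (ℓ : ℤ) - 1 - ℓ = i by ring] at this
  · intro h j
    have hj := (key j).2 (h _)
    exact ⟨hj, hj.span_eq_top_of_card_eq_finrank' (by simp)⟩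

/-- The right side does not involve `U`: this is what gets differentiated later. Plain columns of
`U` are used, so the extension signs move into the constant. -/
theorem sum_twist_mul {U : Matrix (Fin (k + ℓ)) (Fin n) ℝ} (hU : U ∈ MatCirc k ℓ n)
    (c : Fin n) (b : Fin (k + ℓ)) :
    ∑ a, twist k ℓ U a c * U a (cyc n ((c : ℕ) - ℓ + (b : ℕ))) = pairingValue k ℓ n c b := by
  have h := (eq_twistColumn_iff hU ((c : ℤ) + 1) (twistColumn k ℓ U ((c : ℤ) + 1))).1 rfl b
  rw [pairingValue, ← h, dotProduct, Finset.mul_sum]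
  refine Finset.sum_congr rfl fun a _ => ?_
  rw [column_eq, mul_left_comm, inv_mul_cancel_left₀ (columnSign_ne_zero _)]
  rw [show ((c : ℕ) : ℤ) + 1 - ℓ + (b : ℕ) - 1 = (c : ℕ) - ℓ + (b : ℕ) by ring]
  rfl

/-- The window of `τ(U)` at `i`, transposed, times the window of `U` at `i - ℓ` is lower triangular
with nonzero diagonal, hence invertible. -/
theorem twist_mem {U : Matrix (Fin (k + ℓ)) (Fin n) ℝ} (hU : U ∈ MatCirc k ℓ n) :
    twist k ℓ U ∈ MatCirc k ℓ n := by
  rw [mem_MatCirc_iff, circularMinors_ne_zero_iff]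
  intro i hi
  -- For `a ≤ b` the offset `b - a` lies in `[0, r)`, where the pairing is prescribed; entries below
  -- the diagonal are unknown and not needed.
  have hentry : ∀ a b : Fin (k + ℓ), (a : ℕ) ≤ b →
      ((cyclicWindow (twist k ℓ U) i)ᵀ * cyclicWindow U (i - ℓ)) a b =
        pairingValue k ℓ n (cyc n (i + (a : ℕ))) ((b : ℕ) - a) := fun a b hab => by
    have := sum_twist_mul hU (cyc n (i + (a : ℕ))) ⟨(b : ℕ) - a, by omega⟩
    rw [← this, Matrix.mul_apply]
    refine Finset.sum_congr rfl fun d _ => ?_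
    rw [sub_add_eq_add_sub, add_sub_assoc, cyc_coe_add]
    simp only [cyclicWindow, Matrix.transpose_apply, Matrix.submatrix_apply, id]
    rw [show i - (ℓ : ℤ) + (b : ℕ) = i + (a : ℕ) + (((b : ℕ) - (a : ℕ) : ℕ) - (ℓ : ℤ)) by
      push_cast [hab]; ring]
  have htri : ((cyclicWindow (twist k ℓ U) i)ᵀ * cyclicWindow U (i - ℓ)).det =
      ∏ a : Fin (k + ℓ), pairingValue k ℓ n (cyc n (i + (a : ℕ))) 0 := by
    rw [Matrix.det_of_isLowerTriangular]
    · refine Finset.prod_congr rfl fun a _ => ?_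
      rw [hentry a a le_rfl, Nat.sub_self]
    · intro a b hab
      have hab' : (a : ℕ) < b := hab
      rw [hentry a b hab'.le, pairingValue_of_ne_zero _ (by omega)]
  rw [Matrix.det_mul, Matrix.det_transpose, hi, zero_mul] at htri
  exact Finset.prod_ne_zero_iff.2 (fun a _ => pairingValue_zero_ne_zero _) htri.symm

end CyclicColumns

/-! ### The chart `[Id | A]` and its relation to row spans. -/

section Chart

variable {r n : ℕ}

/-- The first `r` columns of an `r × n` matrix. -/
def leftBlock (h : r ≤ n) (M : Matrix (Fin r) (Fin n) ℝ) : Matrix (Fin r) (Fin r) ℝ :=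
  M.submatrix id (Fin.castLE h)

theorem leftBlock_mul (h : r ≤ n) (g : Matrix (Fin r) (Fin r) ℝ) (M : Matrix (Fin r) (Fin n) ℝ) :
    leftBlock h (g * M) = g * leftBlock h M := by
  ext a b
  simp [leftBlock, Matrix.mul_apply]

theorem chartMatrix_of_lt (A : Coords r n) (a : Fin r) {c : Fin n} (hc : (c : ℕ) < r) :
    chartMatrix A a c = if (a : ℕ) = c then 1 else 0 := by
  simp [chartMatrix, hc]

theorem chartMatrix_of_not_lt (A : Coords r n) (a : Fin r) {c : Fin n} (hc : ¬ (c : ℕ) < r) :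
    chartMatrix A a c = A (a, ⟨(c : ℕ) - r, Nat.sub_lt_sub_right (not_lt.1 hc) c.2⟩) := by
  simp [chartMatrix, hc]

theorem leftBlock_chartMatrix (h : r ≤ n) (A : Coords r n) : leftBlock h (chartMatrix A) = 1 := by
  ext a b
  rw [leftBlock, Matrix.submatrix_apply, chartMatrix_of_lt _ _ (by simp)]
  simp [Matrix.one_apply, Fin.ext_iff]

/-- The matrix `A` such that `M` has the row span of `[Id_r | A]`. -/
noncomputable def chartCoord (h : r ≤ n) (M : Matrix (Fin r) (Fin n) ℝ) : Coords r n :=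
  fun p => ((leftBlock h M)⁻¹ * M) p.1 ⟨r + p.2, by omega⟩

theorem leftBlock_mul_chartMatrix (h : r ≤ n) {M : Matrix (Fin r) (Fin n) ℝ}
    (hM : (leftBlock h M).det ≠ 0) :
    leftBlock h M * chartMatrix (chartCoord h M) = M := by
  have hu : IsUnit (leftBlock h M).det := isUnit_iff_ne_zero.2 hM
  have h1 : chartMatrix (chartCoord h M) = (leftBlock h M)⁻¹ * M := by
    ext a c
    by_cases hc : (c : ℕ) < r
    · rw [chartMatrix_of_lt _ _ hc]
      have h2 : leftBlock h ((leftBlock h M)⁻¹ * M) = 1 := by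
        rw [leftBlock_mul, Matrix.nonsing_inv_mul _ hu]
      have h3 := congrFun (congrFun h2 a) ⟨c, hc⟩
      rw [leftBlock, Matrix.submatrix_apply, Matrix.one_apply] at h3
      simpa [Fin.ext_iff] using h3.symm
    · rw [chartMatrix_of_not_lt _ _ hc, chartCoord]
      exact congrArg _ (Fin.ext (Nat.add_sub_cancel' (not_lt.1 hc)))
  rw [h1, Matrix.mul_nonsing_inv_cancel_left _ _ hu]

theorem rowSpan_mul {g : Matrix (Fin r) (Fin r) ℝ} (hg : g.det ≠ 0)
    (M : Matrix (Fin r) (Fin n) ℝ) : rowSpan (g * M) = rowSpan M := by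
  refine le_antisymm (rowSpan_mul_le _ _) ?_
  conv_lhs => rw [← Matrix.nonsing_inv_mul_cancel_left g M (isUnit_iff_ne_zero.2 hg)]
  exact rowSpan_mul_le _ _

theorem chart_chartCoord (h : r ≤ n) {M : Matrix (Fin r) (Fin n) ℝ}
    (hM : (leftBlock h M).det ≠ 0) : chart (chartCoord h M) = rowSpan M := by
  conv_rhs => rw [← leftBlock_mul_chartMatrix h hM]
  rw [rowSpan_mul hM, chart]

theorem coord_rowSpan (h : r ≤ n) {M : Matrix (Fin r) (Fin n) ℝ}
    (hM : (leftBlock h M).det ≠ 0) : coord r (rowSpan M) = chartCoord h M := by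
  rw [← chart_chartCoord h hM, coord_chart h]

theorem rowSpan_mem_Gr (h : r ≤ n) {M : Matrix (Fin r) (Fin n) ℝ}
    (hM : (leftBlock h M).det ≠ 0) : rowSpan M ∈ Gr r n := by
  have h1 : LinearIndependent ℝ (leftBlock h M).row := by
    rw [Matrix.linearIndependent_rows_iff_isUnit, Matrix.isUnit_iff_isUnit_det]
    exact isUnit_iff_ne_zero.2 hM
  have h2 : LinearIndependent ℝ M.row :=
    LinearIndependent.of_comp (LinearMap.funLeft ℝ ℝ (Fin.castLE h)) h1
  rw [Gr, Set.mem_ofPred_eq, rowSpan, finrank_span_eq_card h2, Fintype.card_fin]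

variable [NeZero n]

theorem leftBlock_eq_cyclicWindow (h : r ≤ n) (M : Matrix (Fin r) (Fin n) ℝ) :
    leftBlock h M = cyclicWindow M 0 := by
  ext a b
  simp only [leftBlock, cyclicWindow, Matrix.submatrix_apply, zero_add]
  congr 1
  exact (cyc_coe (Fin.castLE h b)).symm

theorem det_leftBlock_ne_zero (h : r ≤ n) {M : Matrix (Fin r) (Fin n) ℝ}
    (hM : circularMinors M ≠ 0) : (leftBlock h M).det ≠ 0 := by
  rw [leftBlock_eq_cyclicWindow h]
  exact circularMinors_ne_zero_iff.1 hM 0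

theorem circularMinors_eq_leftBlock (h : r ≤ n) {M : Matrix (Fin r) (Fin n) ℝ}
    (hM : (leftBlock h M).det ≠ 0) :
    circularMinors M =
      (leftBlock h M).det ^ n * circularMinors (chartMatrix (chartCoord h M)) := by
  rw [← circularMinors_mul, leftBlock_mul_chartMatrix h hM]

/-- The set of the matrices `A` for which all circular minors of `[Id_r | A]` are nonzero. -/
def coordCirc (r n : ℕ) : Set (Coords r n) := {A | circularMinors (chartMatrix A) ≠ 0}

theorem chartCoord_mem (h : r ≤ n) {M : Matrix (Fin r) (Fin n) ℝ}
    (hM : circularMinors M ≠ 0) : chartCoord h M ∈ coordCirc r n := fun h0 => by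
  rw [circularMinors_eq_leftBlock h (det_leftBlock_ne_zero h hM), h0, mul_zero] at hM
  exact hM rfl

/-- A Vandermonde matrix with nodes `0, …, n - 1`: any `r` of its columns are independent, as the
nodes are distinct. -/
theorem exists_circularMinors_ne_zero (h : r ≤ n) :
    ∃ M : Matrix (Fin r) (Fin n) ℝ, circularMinors M ≠ 0 := by
  refine ⟨Matrix.of fun a c => ((c : ℕ) : ℝ) ^ (a : ℕ), circularMinors_ne_zero_iff.2 fun i => ?_⟩
  have : cyclicWindow (Matrix.of fun (a : Fin r) (c : Fin n) => ((c : ℕ) : ℝ) ^ (a : ℕ)) i =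
      (Matrix.vandermonde fun b : Fin r => ((cyc n (i + (b : ℕ)) : ℕ) : ℝ))ᵀ := rfl
  rw [this, Matrix.det_transpose, Matrix.det_vandermonde_ne_zero_iff]
  intro a b hab
  exact cyc_add_injective i h (Fin.ext (Nat.cast_injective hab))

variable {k ℓ : ℕ}

theorem mem_GrCirc_iff (h : k + ℓ ≤ n) {X : Submodule ℝ (Fin n → ℝ)} :
    X ∈ GrCirc k ℓ n ↔ ∃ A ∈ coordCirc (k + ℓ) n, chart A = X := by
  constructor
  · rintro ⟨_, U, hU, rfl⟩
    rw [mem_MatCirc_iff] at hU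
    exact ⟨chartCoord h U, chartCoord_mem h hU, chart_chartCoord h (det_leftBlock_ne_zero h hU)⟩
  · rintro ⟨A, hA, rfl⟩
    exact ⟨rowSpan_mem_Gr h (by simp [leftBlock_chartMatrix]), _, mem_MatCirc_iff.2 hA, rfl⟩

theorem chart_mem_GrCirc_iff (h : k + ℓ ≤ n) {A : Coords (k + ℓ) n} :
    chart A ∈ GrCirc k ℓ n ↔ A ∈ coordCirc (k + ℓ) n := by
  rw [mem_GrCirc_iff h]
  constructor
  · rintro ⟨B, hB, hBA⟩
    rwa [← chart_injective h hBA]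
  · intro hA
    exact ⟨A, hA, rfl⟩

theorem inChart_twistGr (h : k + ℓ ≤ n) {A : Coords (k + ℓ) n} (hA : A ∈ coordCirc (k + ℓ) n) :
    inChart (k + ℓ) (twistGr k ℓ n) A = chartCoord h (twist k ℓ (chartMatrix A)) := by
  have hA' := mem_MatCirc_iff.2 hA
  rw [inChart, chart, twistGr_rowSpan hA', coord_rowSpan h]
  exact det_leftBlock_ne_zero h (mem_MatCirc_iff.1 (twist_mem hA'))

end Chart

/-! ### Polynomial functions: closure properties, regularity and density of nonvanishing. -/

section Polynomial

variable {σ : Type*}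

/-- The polynomial functions on the coordinate space `σ → ℝ`. -/
noncomputable def polyFun (σ : Type*) : Subalgebra ℝ ((σ → ℝ) → ℝ) :=
  (MvPolynomial.aeval fun (i : σ) (A : σ → ℝ) => A i).range

theorem coord_mem_polyFun (i : σ) : (fun A : σ → ℝ => A i) ∈ polyFun σ :=
  ⟨MvPolynomial.X i, by simp⟩

theorem const_mem_polyFun (c : ℝ) : (fun _ : σ → ℝ => c) ∈ polyFun σ :=
  (polyFun σ).algebraMap_mem c

theorem mem_polyFun_iff {F : (σ → ℝ) → ℝ} :
    F ∈ polyFun σ ↔ ∃ p : MvPolynomial σ ℝ, ∀ A, MvPolynomial.eval A p = F A := by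
  have key : ∀ (p : MvPolynomial σ ℝ) (A : σ → ℝ),
      MvPolynomial.aeval (fun (i : σ) (A : σ → ℝ) => A i) p A = MvPolynomial.eval A p := by
    intro p A
    induction p using MvPolynomial.induction_on with
    | C a => simp
    | add p q hp hq => simp [hp, hq]
    | mul_X p i hp => simp [hp]
  constructor
  · rintro ⟨p, rfl⟩
    exact ⟨p, fun A => (key p A).symm⟩
  · rintro ⟨p, hp⟩
    exact ⟨p, funext fun A => (key p A).trans (hp A)⟩

theorem sum_mem_polyFun {ι : Type*} (s : Finset ι) {F : ι → (σ → ℝ) → ℝ}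
    (hF : ∀ i, F i ∈ polyFun σ) : (fun A => ∑ i ∈ s, F i A) ∈ polyFun σ := by
  have := (polyFun σ).sum_mem (t := s) fun i _ => hF i
  rwa [show (fun A => ∑ i ∈ s, F i A) = ∑ i ∈ s, F i by ext; simp]

theorem prod_mem_polyFun {ι : Type*} (s : Finset ι) {F : ι → (σ → ℝ) → ℝ}
    (hF : ∀ i, F i ∈ polyFun σ) : (fun A => ∏ i ∈ s, F i A) ∈ polyFun σ := by
  have := (polyFun σ).prod_mem (t := s) fun i _ => hF i
  rwa [show (fun A => ∏ i ∈ s, F i A) = ∏ i ∈ s, F i by ext; simp]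

theorem mul_mem_polyFun {F G : (σ → ℝ) → ℝ} (hF : F ∈ polyFun σ) (hG : G ∈ polyFun σ) :
    (fun A => F A * G A) ∈ polyFun σ :=
  (polyFun σ).mul_mem hF hG

theorem det_mem_polyFun {ι : Type*} [Fintype ι] [DecidableEq ι] {M : (σ → ℝ) → Matrix ι ι ℝ}
    (hM : ∀ i j, (fun A => M A i j) ∈ polyFun σ) : (fun A => (M A).det) ∈ polyFun σ := by
  simp only [Matrix.det_apply']
  exact sum_mem_polyFun _ fun τ => mul_mem_polyFun (const_mem_polyFun _)
    (prod_mem_polyFun _ fun i => hM _ _)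

theorem adjugate_mem_polyFun {ι : Type*} [Fintype ι] [DecidableEq ι]
    {M : (σ → ℝ) → Matrix ι ι ℝ} (hM : ∀ i j, (fun A => M A i j) ∈ polyFun σ) (i j : ι) :
    (fun A => (M A).adjugate i j) ∈ polyFun σ := by
  simp only [Matrix.adjugate_apply]
  refine det_mem_polyFun fun a b => ?_
  by_cases ha : a = j
  · subst ha
    simpa using const_mem_polyFun _
  · simpa [Matrix.updateRow_ne ha] using hM a b

theorem continuous_of_mem_polyFun {F : (σ → ℝ) → ℝ} (hF : F ∈ polyFun σ) : Continuous F := by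
  obtain ⟨p, hp⟩ := mem_polyFun_iff.1 hF
  rw [← funext hp]
  exact p.continuous_eval

theorem differentiable_of_mem_polyFun [Fintype σ] {F : (σ → ℝ) → ℝ} (hF : F ∈ polyFun σ) :
    Differentiable ℝ F := by
  obtain ⟨p, hp⟩ := mem_polyFun_iff.1 hF
  rw [← funext hp]
  clear hp hF
  induction p using MvPolynomial.induction_on with
  | C a => simp
  | add p q hp hq => simpa using hp.fun_add hq
  | mul_X p i hp => simpa using hp.fun_mul (differentiable_apply i)

/-- On the line from `A` to `B` the function is a polynomial in one variable that is nonzero at `t =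
1`, so it has finitely many roots, and `A` is a limit of non-roots. -/
theorem dense_of_mem_polyFun {F : (σ → ℝ) → ℝ} (hF : F ∈ polyFun σ) {B : σ → ℝ}
    (hB : F B ≠ 0) : Dense {A | F A ≠ 0} := by
  obtain ⟨p, hp⟩ := mem_polyFun_iff.1 hF
  intro A
  let q : Polynomial ℝ := MvPolynomial.aeval
    (fun i => Polynomial.C (A i) + Polynomial.X * Polynomial.C (B i - A i)) p
  have hq : ∀ t : ℝ, q.eval t = F (A + t • (B - A)) := by
    intro t
    rw [← hp, ← Polynomial.coe_evalRingHom, show q = MvPolynomial.aeval _ p from rfl, MvPolynomial.aeval_def, MvPolynomial.hom_eval₂]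
    simp only [MvPolynomial.eval, MvPolynomial.coe_eval₂Hom]
    congr 1
    · ext; simp
    · ext; simp
  have hq0 : q ≠ 0 := fun h0 => hB (by simpa [h0] using (hq 1).symm)
  -- The point `t = 0` is removed because `A` itself may be a zero; what remains is closed and
  -- misses `0`.
  have hfin : ({t : ℝ | q.IsRoot t} \ {0}).Finite := (Polynomial.finite_setOfPred_isRoot hq0).sdiff
  have hev : ∀ᶠ t in 𝓝[≠] (0 : ℝ), A + t • (B - A) ∈ {A | F A ≠ 0} := by
    have h1 : ({t : ℝ | q.IsRoot t} \ {0})ᶜ ∈ 𝓝 (0 : ℝ) :=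
      hfin.isClosed.isOpen_compl.mem_nhds (by simp)
    filter_upwards [mem_nhdsWithin_of_mem_nhds h1, self_mem_nhdsWithin] with t ht ht0 h2
    exact ht ⟨(hq t).trans h2, ht0⟩
  have hlim : Filter.Tendsto (fun t : ℝ => A + t • (B - A)) (𝓝[≠] 0) (𝓝 A) := by
    have : Continuous fun t : ℝ => A + t • (B - A) := by fun_prop
    have h2 := this.tendsto 0
    rw [zero_smul, add_zero] at h2
    exact h2.mono_left nhdsWithin_le_nhds
  exact mem_closure_of_tendsto hlim hev

end Polynomial

/-! ### The twist in the chart as a quotient of polynomials. -/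

section Rational

variable {r k ℓ n : ℕ}

theorem chartMatrix_mem_polyFun (a : Fin r) (c : Fin n) :
    (fun A : Coords r n => chartMatrix A a c) ∈ polyFun (Fin r × Fin (n - r)) := by
  by_cases hc : (c : ℕ) < r
  · simp only [chartMatrix_of_lt _ _ hc]
    exact const_mem_polyFun _
  · simp only [chartMatrix_of_not_lt _ _ hc]
    exact coord_mem_polyFun _

variable [NeZero n]

theorem circularMinors_mem_polyFun :
    (fun A : Coords r n => circularMinors (chartMatrix A)) ∈ polyFun (Fin r × Fin (n - r)) := by
  simp only [circularMinors_eq]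
  exact prod_mem_polyFun _ fun i => det_mem_polyFun fun a b => chartMatrix_mem_polyFun _ _

theorem isOpen_coordCirc : IsOpen (coordCirc r n) :=
  isOpen_ne_fun (continuous_of_mem_polyFun circularMinors_mem_polyFun) continuous_const

theorem dense_coordCirc (h : r ≤ n) : Dense (coordCirc r n) := by
  obtain ⟨M, hM⟩ := exists_circularMinors_ne_zero (n := n) h
  exact dense_of_mem_polyFun circularMinors_mem_polyFun (chartCoord_mem h hM)

theorem window_mem_polyFun (j : ℤ) (a b : Fin (k + ℓ)) :
    (fun A : Coords (k + ℓ) n => window k ℓ (chartMatrix A) j a b) ∈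
      polyFun (Fin (k + ℓ) × Fin (n - (k + ℓ))) := by
  simp only [window_eq, Matrix.of_apply]
  exact mul_mem_polyFun (const_mem_polyFun _) (chartMatrix_mem_polyFun _ _)

theorem det_window_chartMatrix_ne_zero {A : Coords (k + ℓ) n} (hA : A ∈ coordCirc (k + ℓ) n)
    (j : ℤ) : (window k ℓ (chartMatrix A) j).det ≠ 0 :=
  (det_window_ne_zero_iff _ _).2 (circularMinors_ne_zero_iff.1 hA _)

/-- A common denominator of the entries of the twist of `[Id_r | A]`. -/
noncomputable def twistDenom (k ℓ n : ℕ) [NeZero n] (A : Coords (k + ℓ) n) : ℝ :=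
  ∏ c : Fin n, (window k ℓ (chartMatrix A) ((c : ℤ) + 1)).det

theorem twistDenom_ne_zero {A : Coords (k + ℓ) n} (hA : A ∈ coordCirc (k + ℓ) n) :
    twistDenom k ℓ n A ≠ 0 :=
  Finset.prod_ne_zero_iff.2 fun _ _ => det_window_chartMatrix_ne_zero hA _

theorem twistDenom_mem_polyFun :
    twistDenom k ℓ n ∈ polyFun (Fin (k + ℓ) × Fin (n - (k + ℓ))) :=
  prod_mem_polyFun _ fun _ => det_mem_polyFun fun _ _ => window_mem_polyFun _ _ _

/-- The twist of `[Id_r | A]`, multiplied by the common denominator of its entries. -/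
noncomputable def twistNum (k ℓ n : ℕ) [NeZero n] (A : Coords (k + ℓ) n) :
    Matrix (Fin (k + ℓ)) (Fin n) ℝ :=
  Matrix.of fun a c =>
    (∏ d ∈ Finset.univ.erase c, (window k ℓ (chartMatrix A) ((d : ℤ) + 1)).det) *
      ∑ b, (window k ℓ (chartMatrix A) ((c : ℤ) + 1))ᵀ.adjugate a b *
        if (b : ℕ) = 0 then (-1 : ℝ) ^ ((c : ℤ) + 1) else 0

theorem twistNum_mem_polyFun (a : Fin (k + ℓ)) (c : Fin n) :
    (fun A => twistNum k ℓ n A a c) ∈ polyFun (Fin (k + ℓ) × Fin (n - (k + ℓ))) :=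
  mul_mem_polyFun
    (prod_mem_polyFun _ fun _ => det_mem_polyFun fun _ _ => window_mem_polyFun _ _ _)
    (sum_mem_polyFun _ fun _ => mul_mem_polyFun
      (adjugate_mem_polyFun (fun _ _ => window_mem_polyFun _ _ _) _ _) (const_mem_polyFun _))

theorem twistNum_eq {A : Coords (k + ℓ) n} (hA : A ∈ coordCirc (k + ℓ) n) :
    twistNum k ℓ n A = twistDenom k ℓ n A • twist k ℓ (chartMatrix A) := by
  ext a c
  have hd := det_window_chartMatrix_ne_zero hA ((c : ℤ) + 1)
  rw [twistNum, Matrix.of_apply, Matrix.smul_apply, twist, Matrix.of_apply, twistColumn,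
    twistDenom, ← Finset.prod_erase_mul _ _ (Finset.mem_univ c), smul_eq_mul, mul_assoc,
    Matrix.inv_def, Matrix.det_transpose, Ring.inverse_eq_inv', Matrix.smul_mulVec,
    Pi.smul_apply, smul_eq_mul, mul_inv_cancel_left₀ hd]
  rfl

theorem twist_chartMatrix_eq_div {A : Coords (k + ℓ) n} (hA : A ∈ coordCirc (k + ℓ) n)
    (a : Fin (k + ℓ)) (c : Fin n) :
    twist k ℓ (chartMatrix A) a c = twistNum k ℓ n A a c / twistDenom k ℓ n A := by
  rw [twistNum_eq hA, Matrix.smul_apply, smul_eq_mul,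
    mul_div_cancel_left₀ _ (twistDenom_ne_zero hA)]

theorem differentiableAt_twist {A : Coords (k + ℓ) n} (hA : A ∈ coordCirc (k + ℓ) n)
    (a : Fin (k + ℓ)) (c : Fin n) :
    DifferentiableAt ℝ (fun A => twist k ℓ (chartMatrix A) a c) A := by
  refine ((differentiable_of_mem_polyFun (twistNum_mem_polyFun a c) A).fun_mul
    ((differentiable_of_mem_polyFun twistDenom_mem_polyFun A).fun_inv
      (twistDenom_ne_zero hA))).congr_of_eventuallyEq ?_
  filter_upwards [isOpen_coordCirc.mem_nhds hA] with B hB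
  rw [twist_chartMatrix_eq_div hB a c, div_eq_mul_inv]

/-- Clearing denominators multiplies the twist by a nonzero scalar, which keeps the row span. The
coordinates can thus be computed from the polynomial matrix `twistNum`, by Cramer's rule for its
left block. -/
theorem chartCoord_twist (h : k + ℓ ≤ n) (p : Fin (k + ℓ) × Fin (n - (k + ℓ))) :
    ∃ F ∈ polyFun (Fin (k + ℓ) × Fin (n - (k + ℓ))),
      ∃ G ∈ polyFun (Fin (k + ℓ) × Fin (n - (k + ℓ))), ∀ A ∈ coordCirc (k + ℓ) n, G A ≠ 0 ∧
        inChart (k + ℓ) (twistGr k ℓ n) A p = F A / G A := by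
  have hblock : ∀ a b, (fun A => leftBlock h (twistNum k ℓ n A) a b) ∈
      polyFun (Fin (k + ℓ) × Fin (n - (k + ℓ))) := fun a b => twistNum_mem_polyFun _ _
  refine ⟨fun A => ∑ b, (leftBlock h (twistNum k ℓ n A)).adjugate p.1 b *
      twistNum k ℓ n A b ⟨(k + ℓ) + p.2, by omega⟩,
    sum_mem_polyFun _ fun b => mul_mem_polyFun (adjugate_mem_polyFun hblock _ _)
      (twistNum_mem_polyFun _ _),
    fun A => (leftBlock h (twistNum k ℓ n A)).det, det_mem_polyFun hblock, fun A hA => ?_⟩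
  have hV : (leftBlock h (twist k ℓ (chartMatrix A))).det ≠ 0 :=
    det_leftBlock_ne_zero h (mem_MatCirc_iff.1 (twist_mem (mem_MatCirc_iff.2 hA)))
  have hD : (twistDenom k ℓ n A • (1 : Matrix (Fin (k + ℓ)) (Fin (k + ℓ)) ℝ)).det ≠ 0 := by
    rw [Matrix.det_smul, Matrix.det_one, mul_one]
    exact pow_ne_zero _ (twistDenom_ne_zero hA)
  have hN : twistNum k ℓ n A =
      (twistDenom k ℓ n A • (1 : Matrix (Fin (k + ℓ)) (Fin (k + ℓ)) ℝ)) *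
        twist k ℓ (chartMatrix A) := by
    rw [twistNum_eq hA, Matrix.smul_mul, Matrix.one_mul]
  have hN' : (leftBlock h (twistNum k ℓ n A)).det ≠ 0 := by
    rw [hN, leftBlock_mul, Matrix.det_mul]
    exact mul_ne_zero hD hV
  refine ⟨hN', ?_⟩
  rw [inChart_twistGr h hA, ← coord_rowSpan h hV, ← rowSpan_mul hD, ← hN, coord_rowSpan h hN',
    chartCoord, Matrix.inv_def, Ring.inverse_eq_inv', Matrix.smul_mul, Matrix.smul_apply,
    smul_eq_mul, inv_mul_eq_div]
  rfl

theorem differentiableAt_inChart_twistGr (h : k + ℓ ≤ n) {A : Coords (k + ℓ) n}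
    (hA : A ∈ coordCirc (k + ℓ) n) :
    DifferentiableAt ℝ (inChart (k + ℓ) (twistGr k ℓ n)) A := by
  rw [differentiableAt_pi]
  intro p
  obtain ⟨F, hF, G, hG, hFG⟩ := chartCoord_twist h p
  refine ((differentiable_of_mem_polyFun hF A).fun_mul
    ((differentiable_of_mem_polyFun hG A).fun_inv (hFG A hA).1)).congr_of_eventuallyEq ?_
  filter_upwards [isOpen_coordCirc.mem_nhds hA] with B hB
  rw [(hFG B hB).2, div_eq_mul_inv]

end Rational

/-! ### Determinants of block triangular maps. -/

section BlockTriangular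

variable {ι κ : Type*} [Fintype ι] [Fintype κ]

theorem det_upperTriangular (a : (ι → ℝ) →ₗ[ℝ] ι → ℝ) (h : (κ → ℝ) →ₗ[ℝ] ι → ℝ)
    (d : (κ → ℝ) →ₗ[ℝ] κ → ℝ) :
    LinearMap.det ((a.coprod h).prod (d ∘ₗ LinearMap.snd ℝ (ι → ℝ) (κ → ℝ))) =
      LinearMap.det a * LinearMap.det d := by
  classical
  rw [← LinearMap.det_toMatrix ((Pi.basisFun ℝ ι).prod (Pi.basisFun ℝ κ)),
    ← LinearMap.det_toMatrix (Pi.basisFun ℝ ι) a, ← LinearMap.det_toMatrix (Pi.basisFun ℝ κ) d,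
    ← Matrix.det_fromBlocks_zero₂₁ _ (LinearMap.toMatrix (Pi.basisFun ℝ κ) (Pi.basisFun ℝ ι) h)]
  congr 1
  ext (i | i) (j | j) <;> simp [LinearMap.toMatrix_apply]

theorem det_lowerTriangular (a : (ι → ℝ) →ₗ[ℝ] ι → ℝ) (h : (ι → ℝ) →ₗ[ℝ] κ → ℝ)
    (d : (κ → ℝ) →ₗ[ℝ] κ → ℝ) :
    LinearMap.det ((a ∘ₗ LinearMap.fst ℝ (ι → ℝ) (κ → ℝ)).prod (h.coprod d)) =
      LinearMap.det a * LinearMap.det d := by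
  classical
  rw [← LinearMap.det_toMatrix ((Pi.basisFun ℝ ι).prod (Pi.basisFun ℝ κ)),
    ← LinearMap.det_toMatrix (Pi.basisFun ℝ ι) a, ← LinearMap.det_toMatrix (Pi.basisFun ℝ κ) d,
    ← Matrix.det_fromBlocks_zero₁₂ _ (LinearMap.toMatrix (Pi.basisFun ℝ ι) (Pi.basisFun ℝ κ) h)]
  congr 1
  ext (i | i) (j | j) <;> simp [LinearMap.toMatrix_apply]

end BlockTriangular

/-! ### Linear maps on matrix spaces and their determinants. -/

section Coordinates

variable {r n s : ℕ}

/-- A family of numbers indexed by pairs, as a matrix. -/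
def toMat : (Fin r × Fin s → ℝ) →ₗ[ℝ] Matrix (Fin r) (Fin s) ℝ where
  toFun x := Matrix.of fun a b => x (a, b)
  map_add' _ _ := rfl
  map_smul' _ _ := rfl

/-- A matrix, as a family of numbers indexed by pairs. -/
def ofMat : Matrix (Fin r) (Fin s) ℝ →ₗ[ℝ] Fin r × Fin s → ℝ where
  toFun M p := M p.1 p.2
  map_add' _ _ := rfl
  map_smul' _ _ := rfl

theorem toMat_apply (x : Fin r × Fin s → ℝ) (a : Fin r) (b : Fin s) : toMat x a b = x (a, b) := rfl

theorem ofMat_apply (M : Matrix (Fin r) (Fin s) ℝ) (p : Fin r × Fin s) :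
    ofMat M p = M p.1 p.2 := rfl

theorem toMat_ofMat (M : Matrix (Fin r) (Fin s) ℝ) : toMat (ofMat M) = M := rfl

/-- The linear part `δ ↦ [0 | δ]` of the map `A ↦ [Id_r | A]`. -/
def zeroBlock : Coords r n →ₗ[ℝ] Matrix (Fin r) (Fin n) ℝ where
  toFun δ := Matrix.of fun a c =>
    if h : (c : ℕ) < r then 0
    else δ (a, ⟨(c : ℕ) - r, Nat.sub_lt_sub_right (not_lt.1 h) c.2⟩)
  map_add' δ δ' := by
    ext a c
    by_cases h : (c : ℕ) < r <;> simp [h]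
  map_smul' t δ := by
    ext a c
    by_cases h : (c : ℕ) < r <;> simp [h]

/-- The block matrix `[X | δ]`, as a linear equivalence. -/
def blockEquiv (h : r ≤ n) :
    ((Fin r × Fin r → ℝ) × Coords r n) ≃ₗ[ℝ] (Fin r × Fin n → ℝ) where
  toFun x p :=
    if h : (p.2 : ℕ) < r then x.1 (p.1, ⟨p.2, h⟩)
    else x.2 (p.1, ⟨(p.2 : ℕ) - r, Nat.sub_lt_sub_right (not_lt.1 h) p.2.2⟩)
  map_add' x y := by
    ext p
    by_cases h : (p.2 : ℕ) < r <;> simp [h]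
  map_smul' t x := by
    ext p
    by_cases h : (p.2 : ℕ) < r <;> simp [h]
  invFun M := (fun p => M (p.1, Fin.castLE h p.2), fun p => M (p.1, ⟨r + p.2, by omega⟩))
  left_inv x := by
    ext p <;> simp
  right_inv M := by
    ext ⟨a, c⟩
    by_cases h : (c : ℕ) < r
    · simp [h]
    · simp [h, Nat.add_sub_cancel' (not_lt.1 h)]

/-- Left multiplication `δ ↦ P δ`. -/
noncomputable def leftMul (P : Matrix (Fin r) (Fin r) ℝ) :
    (Fin r × Fin s → ℝ) →ₗ[ℝ] Fin r × Fin s → ℝ :=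
  Matrix.toLin' (P ⊗ₖ (1 : Matrix (Fin s) (Fin s) ℝ))

theorem toMat_leftMul (P : Matrix (Fin r) (Fin r) ℝ) (x : Fin r × Fin s → ℝ) :
    toMat (leftMul P x) = P * toMat x := by
  ext a c
  simp [toMat_apply, leftMul, Matrix.mulVec, dotProduct, Fintype.sum_prod_type, Matrix.one_apply,
    Matrix.mul_apply]

theorem det_leftMul (P : Matrix (Fin r) (Fin r) ℝ) :
    LinearMap.det (leftMul (s := s) P) = P.det ^ s := by
  simp [leftMul, Matrix.det_kronecker]

/-- Right multiplication `X ↦ X P`. -/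
noncomputable def rightMul (P : Matrix (Fin s) (Fin s) ℝ) :
    (Fin r × Fin s → ℝ) →ₗ[ℝ] Fin r × Fin s → ℝ :=
  Matrix.toLin' ((1 : Matrix (Fin r) (Fin r) ℝ) ⊗ₖ Pᵀ)

theorem toMat_rightMul (P : Matrix (Fin s) (Fin s) ℝ) (x : Fin r × Fin s → ℝ) :
    toMat (rightMul P x) = toMat x * P := by
  ext a c
  simp [toMat_apply, rightMul, Matrix.mulVec, dotProduct, Fintype.sum_prod_type, Matrix.one_apply,
    Matrix.mul_apply, mul_comm]

theorem det_rightMul (P : Matrix (Fin s) (Fin s) ℝ) :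
    LinearMap.det (rightMul (r := r) P) = P.det ^ r := by
  simp [rightMul, Matrix.det_kronecker]

/-- The map `X ↦ -Xᵀ`. -/
def negTranspose (r : ℕ) : (Fin r × Fin r → ℝ) →ₗ[ℝ] Fin r × Fin r → ℝ where
  toFun x p := -x (p.2, p.1)
  map_add' x y := by ext p; simp; ring
  map_smul' t x := by ext p; simp

theorem toMat_negTranspose (x : Fin r × Fin r → ℝ) : toMat (negTranspose r x) = -(toMat x)ᵀ := rfl

/-- The map is an involution; its exact sign plays no role. -/
theorem det_negTranspose (r : ℕ) :
    LinearMap.det (negTranspose r) = 1 ∨ LinearMap.det (negTranspose r) = -1 := by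
  rw [← mul_self_eq_one_iff, ← LinearMap.det_comp,
    show negTranspose r ∘ₗ negTranspose r = LinearMap.id from
      LinearMap.ext fun x => funext fun p => neg_neg _, LinearMap.det_id]

/-- The map `X ↦ X B`, from square matrices to matrices of coordinates. -/
noncomputable def mulCoords (B : Coords r n) : (Fin r × Fin r → ℝ) →ₗ[ℝ] Coords r n where
  toFun x := ofMat (toMat x * toMat B)
  map_add' x y := by rw [map_add, Matrix.add_mul, map_add]
  map_smul' t x := by rw [map_smul, Matrix.smul_mul, map_smul]; rfl

/-- This is `X [Id | B] + [0 | δ] = [X | X B + δ]`. It makes the passage from `(X, δ)` to a tangent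
matrix block triangular. -/
theorem chartMatrix_mul_add (h : r ≤ n) (X : Fin r × Fin r → ℝ) (B δ : Coords r n) :
    toMat (blockEquiv h (X, mulCoords B X + δ)) = toMat X * chartMatrix B + zeroBlock δ := by
  ext a c
  by_cases hc : (c : ℕ) < r
  · have : ∀ b : Fin r, chartMatrix B b c = if b = ⟨c, hc⟩ then 1 else 0 := fun b => by
      simp [chartMatrix_of_lt _ _ hc, Fin.ext_iff]
    simp [toMat_apply, blockEquiv, zeroBlock, hc, Matrix.mul_apply, this]
  · simp [toMat_apply, ofMat_apply, blockEquiv, zeroBlock, hc, Matrix.mul_apply, mulCoords,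
      chartMatrix_of_not_lt _ _ hc]

theorem mul_zeroBlock (P : Matrix (Fin r) (Fin r) ℝ) (δ : Coords r n) :
    P * zeroBlock δ = zeroBlock (leftMul P δ) := by
  ext a c
  have := fun c => congrFun (congrFun (toMat_leftMul P δ) a) c
  by_cases hc : (c : ℕ) < r
  · simp [zeroBlock, hc, Matrix.mul_apply]
  · have h1 := congrFun (congrFun (toMat_leftMul P δ) a)
      ⟨(c : ℕ) - r, Nat.sub_lt_sub_right (not_lt.1 hc) c.2⟩
    rw [Matrix.mul_apply] at h1
    simpa [zeroBlock, hc, Matrix.mul_apply, toMat_apply] using h1.symm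

end Coordinates

/-! ### Determinants of the pairing maps and the Jacobian identity. -/

section Pairing

variable {r n : ℕ} [NeZero n]

/-- The matrix of the map which sends `M` to the family of the pairings of the column `c` of `M`
with the column `c + z + b` of `U`. -/
noncomputable def pairLeft (z : ℤ) (U : Matrix (Fin r) (Fin n) ℝ) :
    Matrix (Fin r × Fin n) (Fin r × Fin n) ℝ :=
  Matrix.blockDiagonal fun c : Fin n => (cyclicWindow U ((c : ℕ) + z))ᵀ

theorem pairLeft_mulVec (z : ℤ) (U : Matrix (Fin r) (Fin n) ℝ) (x : Fin r × Fin n → ℝ)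
    (b : Fin r) (c : Fin n) :
    (pairLeft z U *ᵥ x) (b, c) = ∑ a, toMat x a c * U a (cyc n ((c : ℕ) + z + (b : ℕ))) := by
  simp [pairLeft, Matrix.mulVec, dotProduct, Fintype.sum_prod_type, Matrix.blockDiagonal_apply,
    cyclicWindow, toMat_apply, mul_comm]

theorem det_pairLeft (z : ℤ) (U : Matrix (Fin r) (Fin n) ℝ) :
    (pairLeft z U).det = circularMinors U := by
  rw [pairLeft, Matrix.det_blockDiagonal, circularMinors_eq_shift U z]
  simp only [Matrix.det_transpose]

/-- The permutation `(b, c) ↦ (b, c + z + b)`. -/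
def shearPerm (r n : ℕ) [NeZero n] (z : ℤ) : Equiv.Perm (Fin r × Fin n) where
  toFun p := (p.1, cycShift n (z + (p.1 : ℕ)) p.2)
  invFun p := (p.1, (cycShift n (z + (p.1 : ℕ))).symm p.2)
  left_inv p := by simp
  right_inv p := by simp

/-- The matrix of the map which sends `M` to the family of the pairings of the column `c` of `V`
with the column `c + z + b` of `M`. -/
noncomputable def pairRight (z : ℤ) (V : Matrix (Fin r) (Fin n) ℝ) :
    Matrix (Fin r × Fin n) (Fin r × Fin n) ℝ :=
  (Matrix.blockDiagonal fun p : Fin n =>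
    (cyclicWindow V ((p : ℕ) + (1 - r - z)))ᵀ.submatrix Fin.revPerm id).submatrix
      (shearPerm r n z) id

/-- Column `p` of `M` is paired with the columns `p - z - b` of `V`. For `b < r` these form the
window of `V` starting at `p + 1 - r - z`, read backwards; this explains the shear of the indices
and the reversal. -/
theorem pairRight_mulVec (z : ℤ) (V : Matrix (Fin r) (Fin n) ℝ) (x : Fin r × Fin n → ℝ)
    (b : Fin r) (c : Fin n) :
    (pairRight z V *ᵥ x) (b, c) = ∑ a, V a c * toMat x a (cyc n ((c : ℕ) + z + (b : ℕ))) := by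
  have hV : ∀ a, cyclicWindow V ((cyc n ((c : ℕ) + (z + (b : ℕ))) : ℕ) + (1 - r - z)) a b.rev =
      V a c := fun a => by
    rw [cyclicWindow_cyc, cyclicWindow, Matrix.submatrix_apply, Fin.val_rev,
      Nat.cast_sub (by omega)]
    push_cast
    rw [show ((c : ℕ) : ℤ) + (z + (b : ℕ)) + (1 - r - z) + (r - ((b : ℕ) + 1)) = (c : ℕ) by ring,
      cyc_coe]
    rfl
  simp [pairRight, Matrix.mulVec, dotProduct, Fintype.sum_prod_type, Matrix.blockDiagonal_apply,
    shearPerm, cycShift_apply, hV, toMat_apply, add_assoc]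

/-- The sign is that of the shear times one reversal for each of the `n` blocks. It is chosen before
`V`, which yields a uniform sign in the end. -/
theorem exists_det_pairRight (r n : ℕ) [NeZero n] (z : ℤ) : ∃ ε : ℝ, (ε = 1 ∨ ε = -1) ∧
    ∀ V : Matrix (Fin r) (Fin n) ℝ, (pairRight z V).det = ε * circularMinors V := by
  refine ⟨((Equiv.Perm.sign (shearPerm r n z) : ℤ) : ℝ) *
    ((Equiv.Perm.sign (Fin.revPerm (n := r)) : ℤ) : ℝ) ^ n, ?_, fun V => ?_⟩
  · rw [← Int.cast_pow, ← Int.cast_mul, ← Units.val_pow_eq_pow_val, ← Units.val_mul]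
    rcases Int.units_eq_one_or
      (Equiv.Perm.sign (shearPerm r n z) * Equiv.Perm.sign (Fin.revPerm (n := r)) ^ n)
      with h | h <;> simp [h]
  · rw [pairRight, Matrix.det_permute, Matrix.det_blockDiagonal,
      circularMinors_eq_shift V (1 - r - z)]
    simp only [Matrix.det_permute, Matrix.det_transpose, Finset.prod_mul_distrib,
      Finset.prod_const, Finset.card_univ, Fintype.card_fin, mul_assoc]

/-- The Jacobian determinant of a map `A ↦ B` of coordinate matrices, for which all pairings
of the column `c` of `V = P [Id_r | B]` with the column `c + z + b` of `U = [Id_r | A]`, `b < r`,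
are constant. -/
theorem exists_det_of_pairing (h : r ≤ n) (z : ℤ) : ∃ ε : ℝ, (ε = 1 ∨ ε = -1) ∧
    ∀ (A B : Coords r n) (P : Matrix (Fin r) (Fin r) ℝ)
      (DP : Coords r n →ₗ[ℝ] Matrix (Fin r) (Fin r) ℝ) (Df : Coords r n →ₗ[ℝ] Coords r n),
      P.det ≠ 0 →
      (∀ (δ : Coords r n) (b : Fin r) (c : Fin n),
        ∑ a, (DP δ * chartMatrix B + P * zeroBlock (Df δ)) a c *
            chartMatrix A a (cyc n ((c : ℕ) + z + (b : ℕ))) +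
          ∑ a, (P * chartMatrix B) a c * zeroBlock δ a (cyc n ((c : ℕ) + z + (b : ℕ))) = 0) →
      circularMinors (chartMatrix A) * LinearMap.det Df = ε * circularMinors (chartMatrix B) := by
  obtain ⟨ε, hε, hR⟩ := exists_det_pairRight r n z
  have hT := det_negTranspose r
  set τ := LinearMap.det (negTranspose r) with hτ
  -- The factors come from the minus sign in `K(dV) = -R(dU)` on a space of dimension `r n`, from `X
  -- ↦ -Xᵀ`, and from the determinant of `R`.
  refine ⟨(-1) ^ (r * n) * τ * ε, ?_, fun A B P DP Df hP hrel => ?_⟩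
  · rcases hε with rfl | rfl <;> rcases hT with h1 | h1 <;>
      rcases neg_one_pow_eq_or ℝ (r * n) with h2 | h2 <;> simp [h1, h2]
  let J := blockEquiv h
  let K := Matrix.toLin' (pairLeft z (chartMatrix A))
  let R := Matrix.toLin' (pairRight z (P * chartMatrix B))
  -- `J ∘ Θ` sends `(X, δ)` to `dU = X [Id | A] + [0 | δ]`, and `J ∘ Ψ ∘ M` sends it to the
  -- corresponding `dV`. Here `M` computes `Y = -Xᵀ P + DP δ` and `Df δ`, and `Ψ` assembles `Y [Id |
  -- B] + [0 | P Df δ]` in block form.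
  let Θ := (LinearMap.id ∘ₗ LinearMap.fst ℝ (Fin r × Fin r → ℝ) (Coords r n)).prod
    ((mulCoords A).coprod LinearMap.id)
  let Ψ := (LinearMap.id ∘ₗ LinearMap.fst ℝ (Fin r × Fin r → ℝ) (Coords r n)).prod
    ((mulCoords B).coprod (leftMul P))
  let M := ((rightMul P ∘ₗ negTranspose r).coprod (ofMat ∘ₗ DP)).prod
    (Df ∘ₗ LinearMap.snd ℝ (Fin r × Fin r → ℝ) (Coords r n))
  have hΘ : ∀ X δ, toMat (J (Θ (X, δ))) = toMat X * chartMatrix A + zeroBlock δ := fun X δ =>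
    chartMatrix_mul_add h X A δ
  have hΨ : ∀ X δ, toMat (J (Ψ (M (X, δ)))) =
      -((toMat X)ᵀ * (P * chartMatrix B)) + (DP δ * chartMatrix B + P * zeroBlock (Df δ)) :=
    fun X δ => by
      have hY : toMat (rightMul P (negTranspose r X) + ofMat (DP δ)) =
          -((toMat X)ᵀ * P) + DP δ := by
        rw [map_add, toMat_rightMul, toMat_negTranspose, toMat_ofMat, Matrix.neg_mul]
      refine (chartMatrix_mul_add h (rightMul P (negTranspose r X) + ofMat (DP δ)) B
        (leftMul P (Df δ))).trans ?_
      rw [hY, Matrix.add_mul, Matrix.neg_mul, Matrix.mul_assoc, ← mul_zeroBlock, add_assoc]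
  have key : K ∘ₗ J.toLinearMap ∘ₗ Ψ ∘ₗ M = (-1 : ℝ) • (R ∘ₗ J.toLinearMap ∘ₗ Θ) := by
    refine LinearMap.ext fun ⟨X, δ⟩ => funext fun ⟨b, c⟩ => ?_
    -- The pairing of `Xᵀ V` with `U` equals that of `V` with `X U`, so the contributions of the
    -- added directions `X` cancel; the `δ` part is `hrel`.
    have h1 : ((toMat X)ᵀ * (P * chartMatrix B))ᵀ * chartMatrix A =
        (P * chartMatrix B)ᵀ * (toMat X * chartMatrix A) := by
      rw [Matrix.transpose_mul, Matrix.transpose_transpose, Matrix.mul_assoc]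
    have h2 := congrFun (congrFun h1 c) (cyc n ((c : ℕ) + z + (b : ℕ)))
    rw [Matrix.mul_apply, Matrix.mul_apply] at h2
    simp only [Matrix.transpose_apply] at h2
    change (pairLeft z (chartMatrix A) *ᵥ J (Ψ (M (X, δ)))) (b, c) =
      (-1 : ℝ) * (pairRight z (P * chartMatrix B) *ᵥ J (Θ (X, δ))) (b, c)
    rw [pairLeft_mulVec, pairRight_mulVec, hΘ, hΨ]
    simp only [Matrix.add_apply, Matrix.neg_apply, add_mul, mul_add, neg_mul, Finset.sum_add_distrib, Finset.sum_neg_distrib]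
    have h3 := hrel δ b c
    simp only [Matrix.add_apply, add_mul, Finset.sum_add_distrib] at h3
    linarith
  -- Both sides of `key` go between different spaces; composing with `J⁻¹` gives endomorphisms, in
  -- which `K` and `R` appear conjugated by `J`.
  have hdet := congrArg LinearMap.det
    (congrArg (fun f => J.symm.toLinearMap ∘ₗ f) key)
  have e1 : J.symm.toLinearMap ∘ₗ K ∘ₗ J.toLinearMap ∘ₗ Ψ ∘ₗ M =
      (J.symm.toLinearMap ∘ₗ K ∘ₗ J.symm.symm.toLinearMap) ∘ₗ (Ψ ∘ₗ M) := rfl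
  have e2 : J.symm.toLinearMap ∘ₗ ((-1 : ℝ) • (R ∘ₗ J.toLinearMap ∘ₗ Θ)) =
      (J.symm.toLinearMap ∘ₗ ((-1 : ℝ) • R) ∘ₗ J.symm.symm.toLinearMap) ∘ₗ Θ :=
    LinearMap.ext fun _ => rfl
  simp only [e1, e2] at hdet
  rw [LinearMap.det_comp, LinearMap.det_conj, LinearMap.det_comp _ Θ, LinearMap.det_conj,
    LinearMap.det_comp, det_lowerTriangular, det_lowerTriangular, det_upperTriangular,
    LinearMap.det_comp, det_rightMul, det_leftMul, LinearMap.det_id, LinearMap.det_id,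
    LinearMap.det_smul, LinearMap.det_toLin', LinearMap.det_toLin', det_pairLeft, hR,
    circularMinors_mul, ← hτ] at hdet
  have hfin : Module.finrank ℝ (Fin r × Fin n → ℝ) = r * n := by simp
  have hpow : P.det ^ n = P.det ^ (n - r) * P.det ^ r := by
    rw [← pow_add, Nat.sub_add_cancel h]
  have hττ : τ * τ = 1 := mul_self_eq_one_iff.2 hT
  rw [hfin, hpow] at hdet
  have hne : P.det ^ (n - r) * P.det ^ r ≠ 0 := mul_ne_zero (pow_ne_zero _ hP) (pow_ne_zero _ hP)
  refine mul_left_cancel₀ hne ?_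
  -- Multiplying by `τ` moves this sign to the other side, since `τ² = 1`.
  linear_combination τ * hdet - (P.det ^ (n - r) * P.det ^ r *
    circularMinors (chartMatrix A) * LinearMap.det Df) * hττ

end Pairing

/-! ### Differentiating the constant pairings, and the pullback of the form. -/

section Jacobian

variable {r k ℓ n : ℕ}

/-- An entry of `[0 | δ]`, as a continuous linear function of `δ`. -/
noncomputable def zeroBlockEntry (a : Fin r) (c : Fin n) : Coords r n →L[ℝ] ℝ :=
  LinearMap.toContinuousLinearMap
    { toFun := fun δ => zeroBlock δ a c
      map_add' := fun δ δ' => by rw [map_add]; rfl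
      map_smul' := fun t δ => by rw [map_smul]; rfl }

theorem zeroBlockEntry_apply (a : Fin r) (c : Fin n) (δ : Coords r n) :
    zeroBlockEntry a c δ = zeroBlock δ a c := rfl

theorem chartMatrix_eq_add (A : Coords r n) (a : Fin r) (c : Fin n) :
    chartMatrix A a c = chartMatrix 0 a c + zeroBlockEntry a c A := by
  rw [zeroBlockEntry_apply]
  by_cases hc : (c : ℕ) < r <;> simp [zeroBlock, chartMatrix, hc]

theorem hasFDerivAt_chartMatrix (A : Coords r n) (a : Fin r) (c : Fin n) :
    HasFDerivAt (fun A : Coords r n => chartMatrix A a c) (zeroBlockEntry a c) A := by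
  rw [funext fun A => chartMatrix_eq_add A a c]
  exact (zeroBlockEntry a c).hasFDerivAt.const_add _

/-- A linear map acts on top forms by its determinant, so invariance of the form up to `ε` reduces
to the Jacobian identity `hdet`. -/
theorem pullback_canonicalForm (h : r ≤ n) {F : Submodule ℝ (Fin n → ℝ) → Submodule ℝ (Fin n → ℝ)}
    {A : Coords r n} {ε : ℝ} (h1 : circularMinors (chartMatrix A) ≠ 0)
    (h2 : circularMinors (chartMatrix (inChart r F A)) ≠ 0)
    (hdet : circularMinors (chartMatrix A) * LinearMap.det (fderiv ℝ (inChart r F) A).toLinearMap =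
      ε * circularMinors (chartMatrix (inChart r F A))) :
    pullback r F (canonicalForm r n) (chart A) = ε • canonicalForm r n (chart A) := by
  ext v
  have h3 := (Pi.basisFun ℝ (Fin r × Fin (n - r))).det_comp
    (fderiv ℝ (inChart r F) A).toLinearMap v
  rw [pullback, coord_chart h]
  change (circularMinors (chartMatrix (inChart r F A)))⁻¹ *
      (Pi.basisFun ℝ (Fin r × Fin (n - r))).det ((fderiv ℝ (inChart r F) A).toLinearMap ∘ v) =
    ε * ((circularMinors (chartMatrix (coord r (chart A))))⁻¹ *
      (Pi.basisFun ℝ (Fin r × Fin (n - r))).det v)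
  rw [h3, coord_chart h, inv_mul_eq_iff_eq_mul₀ h2]
  field_simp
  linear_combination (Pi.basisFun ℝ (Fin r × Fin (n - r))).det v * hdet

variable [NeZero n]

/-- The differential of the first `k + ℓ` columns of the twist of `[Id | A]`. -/
noncomputable def leftBlockDeriv (h : k + ℓ ≤ n) (A : Coords (k + ℓ) n) :
    Coords (k + ℓ) n →ₗ[ℝ] Matrix (Fin (k + ℓ)) (Fin (k + ℓ)) ℝ where
  toFun δ := Matrix.of fun a b =>
    fderiv ℝ (fun A => twist k ℓ (chartMatrix A) a (Fin.castLE h b)) A δ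
  map_add' δ δ' := by ext a b; simp
  map_smul' t δ := by ext a b; simp

/-- The product rule for the constant pairings of `V = P [Id | B]` with `[Id | A]`; it supplies the
hypothesis of `exists_det_of_pairing` with `z = -ℓ`. -/
theorem deriv_pairing_eq_zero (h : k + ℓ ≤ n) {A : Coords (k + ℓ) n}
    (hA : A ∈ coordCirc (k + ℓ) n) (δ : Coords (k + ℓ) n) (b : Fin (k + ℓ)) (c : Fin n) :
    ∑ a, (leftBlockDeriv h A δ * chartMatrix (inChart (k + ℓ) (twistGr k ℓ n) A) +
        leftBlock h (twist k ℓ (chartMatrix A)) *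
          zeroBlock (fderiv ℝ (inChart (k + ℓ) (twistGr k ℓ n)) A δ)) a c *
            chartMatrix A a (cyc n ((c : ℕ) + -(ℓ : ℤ) + (b : ℕ))) +
      ∑ a, (leftBlock h (twist k ℓ (chartMatrix A)) *
          chartMatrix (inChart (k + ℓ) (twistGr k ℓ n) A)) a c *
            zeroBlock δ a (cyc n ((c : ℕ) + -(ℓ : ℤ) + (b : ℕ))) = 0 := by
  set f := inChart (k + ℓ) (twistGr k ℓ n) with hf
  set e := cyc n ((c : ℕ) + -(ℓ : ℤ) + (b : ℕ)) with he
  have hP : ∀ a d, HasFDerivAt (fun A => twist k ℓ (chartMatrix A) a (Fin.castLE h d))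
      (fderiv ℝ (fun A => twist k ℓ (chartMatrix A) a (Fin.castLE h d)) A) A := fun a d =>
    (differentiableAt_twist hA a _).hasFDerivAt
  have hC : ∀ d, HasFDerivAt (fun A => chartMatrix (f A) d c) _ A := fun d =>
    (hasFDerivAt_chartMatrix (f A) d c).comp A (differentiableAt_inChart_twistGr h hA).hasFDerivAt
  have hsum := HasFDerivAt.fun_sum (u := Finset.univ) fun (a : Fin (k + ℓ)) _ =>
    (HasFDerivAt.fun_sum (u := Finset.univ) fun (d : Fin (k + ℓ)) _ =>
      (hP a d).mul (hC d)).mul (hasFDerivAt_chartMatrix A a e)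
  -- The pairing is constant only on the open set where the twist is defined, hence near `A`, which
  -- suffices for the derivative.
  have hconst : (fun B => ∑ a, (∑ d, twist k ℓ (chartMatrix B) a (Fin.castLE h d) *
      chartMatrix (f B) d c) * chartMatrix B a e) =ᶠ[𝓝 A] fun _ => pairingValue k ℓ n c b := by
    filter_upwards [isOpen_coordCirc.mem_nhds hA] with B hB
    have hB' := mem_MatCirc_iff.2 hB
    rw [← sum_twist_mul hB' c b]
    refine Finset.sum_congr rfl fun a _ => ?_
    have h1 := leftBlock_mul_chartMatrix h
      (det_leftBlock_ne_zero h (mem_MatCirc_iff.1 (twist_mem hB')))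
    rw [← inChart_twistGr h hB] at h1
    have h2 := congrFun (congrFun h1 a) c
    rw [Matrix.mul_apply] at h2
    exact congrArg (· * chartMatrix B a e) h2
  have h0 := congrArg (fun L => L δ)
    (hsum.unique ((hasFDerivAt_const (pairingValue k ℓ n c b) A).congr_of_eventuallyEq hconst))
  rw [← Finset.sum_add_distrib]
  rw [sum_apply] at h0
  refine Eq.trans (Finset.sum_congr rfl fun a _ => ?_) h0
  simp only [add_apply, smul_apply,
    sum_apply, ContinuousLinearMap.comp_apply, zeroBlockEntry_apply,
    smul_eq_mul, Pi.mul_apply, Matrix.add_apply, Matrix.mul_apply, leftBlockDeriv,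
    LinearMap.coe_mk, AddHom.coe_mk, Matrix.of_apply, leftBlock, Matrix.submatrix_apply, id,
    Finset.sum_add_distrib]
  simp only [mul_comm (chartMatrix (f A) _ c)]
  ring

/-- The Jacobian determinant of the twist map in the chart `[Id | A]`. -/
theorem exists_det_fderiv_inChart_twistGr (h : k + ℓ ≤ n) : ∃ ε : ℝ, (ε = 1 ∨ ε = -1) ∧
    ∀ A ∈ coordCirc (k + ℓ) n,
      circularMinors (chartMatrix A) *
          LinearMap.det (fderiv ℝ (inChart (k + ℓ) (twistGr k ℓ n)) A).toLinearMap =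
        ε * circularMinors (chartMatrix (inChart (k + ℓ) (twistGr k ℓ n) A)) := by
  obtain ⟨ε, hε, hdet⟩ := exists_det_of_pairing (n := n) h (-(ℓ : ℤ))
  refine ⟨ε, hε, fun A hA => ?_⟩
  exact hdet A _ (leftBlock h (twist k ℓ (chartMatrix A))) (leftBlockDeriv h A) _
    (det_leftBlock_ne_zero h (mem_MatCirc_iff.1 (twist_mem (mem_MatCirc_iff.2 hA))))
    (deriv_pairing_eq_zero h hA)

theorem inChart_twistGr_mem (h : k + ℓ ≤ n) {A : Coords (k + ℓ) n}
    (hA : A ∈ coordCirc (k + ℓ) n) : inChart (k + ℓ) (twistGr k ℓ n) A ∈ coordCirc (k + ℓ) n := by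
  rw [inChart_twistGr h hA]
  exact chartCoord_mem h (mem_MatCirc_iff.1 (twist_mem (mem_MatCirc_iff.2 hA)))

end Jacobian

end GrassmannTwist

/-- The twist map `τ` descends from `Mat°(k + ℓ, n)` to a rational map of `Gr(k + ℓ, n)`, regular
on the dense open subset `Gr°(k + ℓ, n)`, and `τ^* ω = ± ω` for the canonical form
`ω = ω_{k+ℓ,n}`, with one sign for the whole of `Gr°(k + ℓ, n)`. -/
theorem proposition5p3 (k ℓ m n : ℕ) [NeZero n] (hm : Even m) (hn : k + ℓ + m = n) :
    (∀ U ∈ MatCirc k ℓ n, twist k ℓ U ∈ MatCirc k ℓ n ∧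
      twistGr k ℓ n (rowSpan U) = rowSpan (twist k ℓ U)) ∧
    IsOpen {A : Coords (k + ℓ) n | chart A ∈ GrCirc k ℓ n} ∧
    Dense {A : Coords (k + ℓ) n | chart A ∈ GrCirc k ℓ n} ∧
    (∀ X ∈ GrCirc k ℓ n, chart (coord (k + ℓ) X) = X ∧ twistGr k ℓ n X ∈ GrCirc k ℓ n ∧
      DifferentiableAt ℝ (inChart (k + ℓ) (twistGr k ℓ n)) (coord (k + ℓ) X)) ∧
    (∀ c : Fin (k + ℓ) × Fin (n - (k + ℓ)),
      ∃ p q : MvPolynomial (Fin (k + ℓ) × Fin (n - (k + ℓ))) ℝ, ∀ X ∈ GrCirc k ℓ n,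
        MvPolynomial.eval (coord (k + ℓ) X) q ≠ 0 ∧
        coord (k + ℓ) (twistGr k ℓ n X) c =
          MvPolynomial.eval (coord (k + ℓ) X) p / MvPolynomial.eval (coord (k + ℓ) X) q) ∧
    ∃ ε : ℝ, (ε = 1 ∨ ε = -1) ∧ ∀ X ∈ GrCirc k ℓ n,
      pullback (k + ℓ) (twistGr k ℓ n) (canonicalForm (k + ℓ) n) X =
        ε • canonicalForm (k + ℓ) n X := by
  have h : k + ℓ ≤ n := by omega
  have hset : {A : Coords (k + ℓ) n | chart A ∈ GrCirc k ℓ n} = coordCirc (k + ℓ) n :=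
    Set.ext fun A => chart_mem_GrCirc_iff h
  refine ⟨fun U hU => ⟨twist_mem hU, twistGr_rowSpan hU⟩, hset ▸ isOpen_coordCirc,
    hset ▸ dense_coordCirc h, fun X hX => ?_, fun c => ?_, ?_⟩
  · obtain ⟨A, hA, rfl⟩ := (mem_GrCirc_iff h).1 hX
    have hA' := mem_MatCirc_iff.2 hA
    have hV := mem_MatCirc_iff.1 (twist_mem hA')
    rw [coord_chart h]
    refine ⟨rfl, ?_, differentiableAt_inChart_twistGr h hA⟩
    rw [chart, twistGr_rowSpan hA']
    exact ⟨rowSpan_mem_Gr h (det_leftBlock_ne_zero h hV), _, twist_mem hA', rfl⟩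
  · obtain ⟨F, hF, G, hG, hFG⟩ := chartCoord_twist h c
    obtain ⟨p, hp⟩ := mem_polyFun_iff.1 hF
    obtain ⟨q, hq⟩ := mem_polyFun_iff.1 hG
    refine ⟨p, q, fun X hX => ?_⟩
    obtain ⟨A, hA, rfl⟩ := (mem_GrCirc_iff h).1 hX
    rw [coord_chart h, hp, hq]
    exact hFG A hA
  · obtain ⟨ε, hε, hdet⟩ := exists_det_fderiv_inChart_twistGr (k := k) (ℓ := ℓ) h
    refine ⟨ε, hε, fun X hX => ?_⟩
    obtain ⟨A, hA, rfl⟩ := (mem_GrCirc_iff h).1 hX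
    exact pullback_canonicalForm h hA (inChart_twistGr_mem h hA) (hdet A hA)
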